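/- \textbf{Lemma (ES-Based Strategy in a bounded play region).} Consider pursuers $P_1,\dots,P_{N_p}$ with speeds $v_{P_i}>0$ and capture radii $r_i\ge 0$, and evaders $E_1,\dots,E_{N_e}$ with speeds $v_{E_j}>0$, moving in $\mathbb{R}^3$ (points are written $\mathbf{x}=(x,y,z)$) by $\dot{\mathbf{x}}_{P_i}=v_{P_i}\mathbf{u}_{P_i}$ and $\dot{\mathbf{x}}_{E_j}=v_{E_j}\mathbf{u}_{E_j}$ with headings $\mathbf{u}_{P_i},\mathbf{u}_{E_j}\in\mathbb{S}^2$. Assume $\alpha_{ij}=v_{P_i}/v_{E_j}>1$ for all $i,j$. The play region and its exit are $$\Omega^b_{\rm play}=\{\mathbf{x}\in\mathbb{R}^3 : z\ge 0,\ g(\mathbf{x})\ge 0\},\qquad \mathcal{T}^b=\{\mathbf{x}\in\Omega^b_{\rm play} : z=0\},$$ where $g:\mathbb{R}^3\to\mathbb{R}$ is differentiable, $\{g\ge 0\}$ is convex, $\Omega^b_{\rm play}$ is bounded and has more than one point, and $\mathcal{T}^b\neq\emptyset$. Let $s\subseteq\{1,\dots,N_p\}$ be non-empty and let $E_j$ be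 an evader. When $\|\mathbf{x}_{E_j}-\mathbf{x}_{P_i}\|_2>r_i$ for all $i\in s$, put $$f_{ij}(\mathbf{x})=\|\mathbf{x}-\mathbf{x}_{P_i}\|_2-\alpha_{ij}\|\mathbf{x}-\mathbf{x}_{E_j}\|_2-r_i ,$$ and let $\bar{\mathbb{E}}(s,j)$ be the closure of the evasion space $\mathbb{E}(s,j)=\{\mathbf{x} : f_{ij}(\mathbf{x})>0\ \text{for all } i\in s\}$; it equals $\{\mathbf{x} : f_{ij}(\mathbf{x})\ge 0\ \text{for all } i\in s\}$. The interception point $I^b(s,j)$ is the minimizer of $z$ over $\bar{\mathbb{E}}(s,j)\cap\Omega^b_{\rm play}$, and $z_{I^b(s,j)}$ is its $z$-coordinate; both depend on time through the positions of the players. Suppose that at time $t_0$ we have $\|\mathbf{x}_{E_j}-\mathbf{x}_{P_i}\|_2>r_i$ for all $i\in s$, $\mathbf{x}_{E_j}\in\Omega^b_{\rm play}$ and $\bar{\mathbb{E}}(s,j)\cap\mathcal{T}^b=\emptyset$. Then the interception point exists and is unique at $t_0$, and it differs from $\mathbf{x}_{E_j}$ and from every $\mathbf{x}_{P_i}$,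 $i\in s$. Suppose moreover that at time $t_0$ every pursuer $P_i$ with $i\in s$ uses the heading $$\mathbf{u}_{P_i}=\frac{I^b(s,j)-\mathbf{x}_{P_i}}{\|I^b(s,j)-\mathbf{x}_{P_i}\|_2},$$ and that $E_j$ uses an arbitrary heading $\mathbf{u}_{E_j}\in\mathbb{S}^2$, the velocities at $t_0$ being understood as right derivatives of the positions. Then the interception point exists and is unique also at all times shortly after $t_0$, the right derivative $\dot z_{I^b(s,j)}$ of $z_{I^b(s,j)}$ at $t_0$ exists, and $$\dot z_{I^b(s,j)}\ \ge\ 0 .$$ Moreover, $\dot z_{I^b(s,j)}=0$ if and only if $$\mathbf{u}_{E_j}=\frac{I^b(s,j)-\mathbf{x}_{E_j}}{\|I^b(s,j)-\mathbf{x}_{E_j}\|_2}.$$ -/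

import Mathlib

open Set Filter Topology

/-- Three-dimensional Euclidean space; the coordinates `x 0`, `x 1`, `x 2` are `x`, `y`, `z`. -/
abbrev E3 : Type := EuclideanSpace ℝ (Fin 3)

/-- The parameters of a game with `Np` pursuers and `Ne` evaders: speeds and capture radii, every
pursuer being faster than every evader. -/
structure PursuitGame (Np Ne : ℕ) where
  /-- speeds of the pursuers -/
  vP : Fin Np → ℝ
  /-- speeds of the evaders -/
  vE : Fin Ne → ℝ
  /-- capture radii of the pursuers -/
  r : Fin Np → ℝ
  vP_pos : ∀ i, 0 < vP i
  vE_pos : ∀ j, 0 < vE j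
  r_nonneg : ∀ i, 0 ≤ r i
  one_lt_ratio : ∀ i j, 1 < vP i / vE j

/-- A bounded convex play region `{z ≥ 0, g ≥ 0}` with a (non-empty) planar exit
`{z = 0, g ≥ 0}`, where `g` is differentiable and `{g ≥ 0}` is convex. -/
structure PlayRegion where
  g : E3 → ℝ
  differentiable_g : Differentiable ℝ g
  convex_g : Convex ℝ {x : E3 | 0 ≤ g x}
  bounded : Bornology.IsBounded {x : E3 | 0 ≤ x 2 ∧ 0 ≤ g x}
  nontrivial : {x : E3 | 0 ≤ x 2 ∧ 0 ≤ g x}.Nontrivial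
  exit_nonempty : {x : E3 | x 2 = 0 ∧ 0 ≤ g x}.Nonempty

/-- The play region `Ω`. -/
def PlayRegion.region (R : PlayRegion) : Set E3 := {x | 0 ≤ x 2 ∧ 0 ≤ R.g x}

/-- The exit: the part of the play region in the plane `z = 0`. -/
def PlayRegion.exit (R : PlayRegion) : Set E3 := {x | x ∈ R.region ∧ x 2 = 0}

namespace PursuitGame

variable {Np Ne : ℕ}

/-- The speed ratio `α i j`. -/
noncomputable def ratio (G : PursuitGame Np Ne) (i : Fin Np) (j : Fin Ne) : ℝ := G.vP i / G.vE j

/-- The potential function of pursuer `i` at `p` and evader `j` at `e`. -/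
noncomputable def potential (G : PursuitGame Np Ne) (i : Fin Np) (j : Fin Ne) (p e x : E3) : ℝ :=
  ‖x - p‖ - G.ratio i j * ‖x - e‖ - G.r i

/-- The evasion space of evader `j` at `e` against the coalition `s`, the pursuers being at `p`. -/
def evasionSpace (G : PursuitGame Np Ne) (s : Finset (Fin Np)) (j : Fin Ne)
    (p : Fin Np → E3) (e : E3) : Set E3 :=
  {x | ∀ i ∈ s, 0 < G.potential i j (p i) e x}

/-- The closure of the evasion space. -/
def closedEvasionSpace (G : PursuitGame Np Ne) (s : Finset (Fin Np)) (j : Fin Ne)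
    (p : Fin Np → E3) (e : E3) : Set E3 :=
  closure (G.evasionSpace s j p e)

/-- As long as the evader is not captured, the closure of the evasion space is given by the
non-strict inequalities. -/
theorem closedEvasionSpace_eq (G : PursuitGame Np Ne) (s : Finset (Fin Np)) (j : Fin Ne)
    (p : Fin Np → E3) (e : E3) (h : ∀ i ∈ s, G.r i < ‖e - p i‖) :
    G.closedEvasionSpace s j p e = {x | ∀ i ∈ s, 0 ≤ G.potential i j (p i) e x} := by
  apply Subset.antisymm
  · refine closure_minimal (fun x hx i hi => (hx i hi).le) ?_
    have : {x | ∀ i ∈ s, 0 ≤ G.potential i j (p i) e x}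
        = ⋂ i ∈ s, {x | 0 ≤ G.potential i j (p i) e x} := by
      ext x; simp
    rw [this]
    refine isClosed_biInter fun i _ => isClosed_le continuous_const ?_
    unfold potential
    fun_prop
  · intro x hx
    by_cases hxe : x = e
    · refine subset_closure fun i hi => ?_
      have := h i hi
      subst hxe
      simp only [potential, sub_self, norm_zero, mul_zero]
      linarith
    have hd : 0 < ‖x - e‖ := norm_pos_iff.2 (sub_ne_zero.2 hxe)
    have key : ∀ θ ∈ Ioo (0 : ℝ) 1, x + θ • (e - x) ∈ G.evasionSpace s j p e := by
      intro θ hθ i hi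
      have h1 : ‖x - p i‖ ≤ ‖x + θ • (e - x) - p i‖ + θ * ‖x - e‖ := by
        have : x - p i = (x + θ • (e - x) - p i) + θ • (x - e) := by module
        calc ‖x - p i‖ = ‖(x + θ • (e - x) - p i) + θ • (x - e)‖ := by rw [← this]
          _ ≤ _ := (norm_add_le _ _).trans_eq (by
            rw [norm_smul, Real.norm_of_nonneg hθ.1.le])
      have h2 : ‖x + θ • (e - x) - e‖ = (1 - θ) * ‖x - e‖ := by
        have : x + θ • (e - x) - e = (1 - θ) • (x - e) := by module
        rw [this, norm_smul, Real.norm_of_nonneg (by linarith [hθ.2])]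
      have h3 := hx i hi
      have h4 : 1 < G.ratio i j := G.one_lt_ratio i j
      simp only [potential] at h3 ⊢
      rw [h2]
      nlinarith [mul_pos (mul_pos hθ.1 hd) (sub_pos.2 h4)]
    have ht : Tendsto (fun θ : ℝ => x + θ • (e - x)) (𝓝[>] 0) (𝓝 x) := by
      have : Continuous (fun θ : ℝ => x + θ • (e - x)) := by fun_prop
      simpa using (this.tendsto 0).mono_left nhdsWithin_le_nhds
    exact mem_closure_of_tendsto ht
      (eventually_of_mem (Ioo_mem_nhdsGT one_pos) key)

/-- `x` is an interception point: it minimizes `z` over the part of the closed evasion space that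
lies in the play region. -/
def IsInterceptionPoint (G : PursuitGame Np Ne) (R : PlayRegion) (s : Finset (Fin Np))
    (j : Fin Ne) (p : Fin Np → E3) (e x : E3) : Prop :=
  x ∈ G.closedEvasionSpace s j p e ∩ R.region ∧
    ∀ y ∈ G.closedEvasionSpace s j p e ∩ R.region, x 2 ≤ y 2

/-- The interception point (an arbitrary point if there is none). -/
noncomputable def interceptionPoint (G : PursuitGame Np Ne) (R : PlayRegion) (s : Finset (Fin Np))
    (j : Fin Ne) (p : Fin Np → E3) (e : E3) : E3 :=
  Classical.epsilon (G.IsInterceptionPoint R s j p e)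

end PursuitGame

/-- The unit vector pointing from `a` to `b` (for `a ≠ b`). -/
noncomputable def heading (a b : E3) : E3 := ‖b - a‖⁻¹ • (b - a)

/-- At time `t` a player with speed `v` and position curve `x` moves with heading `u`, a unit
vector: the right derivative of `x` at `t` is `v u`. -/
def MovesWithHeading (v : ℝ) (x : ℝ → E3) (u : E3) (t : ℝ) : Prop :=
  ‖u‖ = 1 ∧ HasDerivWithinAt x (v • u) (Ici t) t

/-! The height of the interception point is the value of a minimization over a fixed convex region
with moving constraints `f i ≥ 0`. Its right derivative is the infimum of the linearized program:
minimize `ℓ d` over the feasible directions `d` with `a i d + c i ≥ 0` for every active `i`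
(`hasDerivWithinAt_value`). No multipliers are needed, because the direction towards the evader
strictly increases every potential and repairs small violations of the constraints.

With the pursuers heading for the interception point, the identity `α * vE = vP` gives `c i = -(vP i
* κ)` with one common `κ = 1 - ⟪heading, uE⟫ ≥ 0`. Directions admissible for the linearized program
therefore satisfy `a i d ≥ 0`, and optimality at `t₀` forces `ℓ d ≥ 0`. If `κ > 0`, the active
inequalities are strict, so `d` can still be tilted towards the exit; this bounds `ℓ d` away from
`0`. If `κ = 0`, then `d = 0` is admissible. Finally `κ = 0` is the equality case of Cauchy–Schwarz
(`exists_hasDerivWithinAt_value`).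

The lower bound on the derivative needs `ξ t` to satisfy the linearized constraints up to `o(t -
t₀)` without a rate of convergence for `ξ`. This comes from concavity of the difference of squares
`concavePotential` (`eventually_linearized`), together with continuity of the interception point
(`tendsto_isInterceptionPoint`). -/

/-! ### Feasible directions of a convex set -/

/-- The directions in which one can move from `x` for a positive time without leaving the convex
set `K`. -/
def feasibleDirections {E : Type*} [AddCommGroup E] [Module ℝ E] (K : Set E) (x : E) : Set E :=
  {d | ∃ h : ℝ, 0 < h ∧ x + h • d ∈ K}

section FeasibleDirections

variable {E : Type*} [AddCommGroup E] [Module ℝ E] {K : Set E} {x : E}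

theorem add_smul_mem_of_le (hK : Convex ℝ K) (hx : x ∈ K) {d : E} {h k : ℝ}
    (hh : x + h • d ∈ K) (hk : 0 ≤ k) (hkh : k ≤ h) : x + k • d ∈ K := by
  rcases hk.eq_or_lt with rfl | hk
  · simpa using hx
  have hpos : 0 < h := hk.trans_le hkh
  have := hK.add_smul_mem hx hh (t := k / h)
    ⟨by positivity, (div_le_one hpos).2 hkh⟩
  rwa [smul_smul, div_mul_cancel₀ _ hpos.ne'] at this

theorem sub_mem_feasibleDirections {y : E} (hy : y ∈ K) : y - x ∈ feasibleDirections K x :=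
  ⟨1, one_pos, by simpa using hy⟩

theorem smul_mem_feasibleDirections {d : E} {c : ℝ} (hc : 0 < c)
    (hd : d ∈ feasibleDirections K x) : c • d ∈ feasibleDirections K x := by
  obtain ⟨h, hh, hm⟩ := hd
  exact ⟨h / c, by positivity, by rwa [smul_smul, div_mul_cancel₀ _ hc.ne']⟩

theorem add_mem_feasibleDirections (hK : Convex ℝ K) (hx : x ∈ K) {d d' : E}
    (hd : d ∈ feasibleDirections K x) (hd' : d' ∈ feasibleDirections K x) :
    d + d' ∈ feasibleDirections K x := by
  obtain ⟨h, hh, hm⟩ := hd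
  obtain ⟨h', hh', hm'⟩ := hd'
  have hk : 0 < min h h' := lt_min hh hh'
  have h1 := add_smul_mem_of_le hK hx hm hk.le (min_le_left _ _)
  have h2 := add_smul_mem_of_le hK hx hm' hk.le (min_le_right _ _)
  -- The midpoint of `x + k • d` and `x + k • d'` is `x + (k / 2) • (d + d')`.
  refine ⟨min h h' / 2, by positivity, ?_⟩
  have := hK h1 h2 (a := 1 / 2) (b := 1 / 2) (by norm_num) (by norm_num) (by norm_num)
  convert this using 1
  module

theorem eventually_add_smul_mem (hK : Convex ℝ K) (hx : x ∈ K) {d : E}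
    (hd : d ∈ feasibleDirections K x) (t₀ : ℝ) :
    ∀ᶠ t in 𝓝[>] t₀, x + (t - t₀) • d ∈ K := by
  obtain ⟨h, hh, hm⟩ := hd
  filter_upwards [Ioo_mem_nhdsGT (lt_add_of_pos_right t₀ hh)] with t ht
  exact add_smul_mem_of_le hK hx hm (by linarith [ht.1]) (by linarith [ht.2])

end FeasibleDirections

theorem HasDerivWithinAt.eventually_nonneg_right {φ : ℝ → ℝ} {φ' t₀ : ℝ}
    (h : HasDerivWithinAt φ φ' (Ici t₀) t₀) (h0 : 0 ≤ φ t₀) (hpos : φ t₀ = 0 → 0 < φ') :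
    ∀ᶠ t in 𝓝[>] t₀, 0 ≤ φ t := by
  rcases h0.eq_or_lt with h0 | h0
  · have hs := (hasDerivWithinAt_iff_tendsto_slope' (by simp)).1 h.Ioi_of_Ici
    filter_upwards [hs.eventually_const_lt (hpos h0.symm), self_mem_nhdsWithin] with t ht htt
    rw [slope_def_field, ← h0, sub_zero] at ht
    have : 0 < t - t₀ := sub_pos.2 htt
    exact ((div_pos_iff_of_pos_right this).1 ht).le
  · have hc := h.continuousWithinAt.mono Ioi_subset_Ici_self
    exact (hc.eventually_const_lt h0).mono fun t ht => ht.le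

/-! ### Right derivative of the value of a constrained program -/

section Sensitivity

variable {E ι : Type*} [NormedAddCommGroup E] [NormedSpace ℝ E] {s : Finset ι} {K : Set E}
  {ℓ : E →L[ℝ] ℝ} {f : ι → ℝ → E → ℝ} {ξ : ℝ → E} {t₀ : ℝ} {a : ι → E →L[ℝ] ℝ} {c : ι → ℝ}

/-- Right derivative of the value of a convex program with right differentiable constraints whose
linearization is strictly feasible: it is the value of the linearized program. -/
theorem hasDerivWithinAt_value (hK : Convex ℝ K)
    (hmem : ∀ᶠ t in 𝓝[≥] t₀, ξ t ∈ K)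
    (hmin : ∀ᶠ t in 𝓝[≥] t₀, ∀ y ∈ K, (∀ i ∈ s, 0 ≤ f i t y) → ℓ (ξ t) ≤ ℓ y)
    (hfeas : ∀ i ∈ s, 0 ≤ f i t₀ (ξ t₀))
    (hderiv : ∀ i ∈ s, ∀ d, HasDerivWithinAt (fun t => f i t (ξ t₀ + (t - t₀) • d))
      (a i d + c i) (Ici t₀) t₀)
    (hlow : ∀ i ∈ s, f i t₀ (ξ t₀) = 0 → ∀ ε > 0, ∀ᶠ t in 𝓝[>] t₀,
      -(ε * (t - t₀)) ≤ a i (ξ t - ξ t₀) + c i * (t - t₀))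
    {d₀ : E} (hd₀ : d₀ ∈ feasibleDirections K (ξ t₀)) (had₀ : ∀ i ∈ s, 0 < a i d₀)
    {W : ℝ} (hW : IsGLB (ℓ '' {d ∈ feasibleDirections K (ξ t₀) |
      ∀ i ∈ s, f i t₀ (ξ t₀) = 0 → 0 ≤ a i d + c i}) W) :
    HasDerivWithinAt (fun t => ℓ (ξ t)) W (Ici t₀) t₀ := by
  have hI : ξ t₀ ∈ K := hmem.self_of_nhdsWithin self_mem_Ici
  refine HasDerivWithinAt.Ici_of_Ioi ?_
  rw [hasDerivWithinAt_iff_tendsto_slope' (by simp), tendsto_order]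
  have hmem' := hmem.filter_mono (nhdsWithin_mono t₀ Ioi_subset_Ici_self)
  have hmin' := hmin.filter_mono (nhdsWithin_mono t₀ Ioi_subset_Ici_self)
  constructor
  · intro b hb
    -- The correction `η • d₀` must cost less than the margin `W - b`.
    obtain ⟨η, hη, hηb⟩ : ∃ η : ℝ, 0 < η ∧ η * ℓ d₀ < W - b := by
      have : Tendsto (fun η : ℝ => η * ℓ d₀) (𝓝[>] 0) (𝓝 (0 * ℓ d₀)) :=
        ((continuous_id.mul continuous_const).tendsto 0).mono_left nhdsWithin_le_nhds
      obtain ⟨η, h1, h2⟩ := ((this.eventually_lt_const (u := W - b) (by simpa using hb)).and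
        self_mem_nhdsWithin).exists
      exact ⟨η, h2, h1⟩
    have hall : ∀ᶠ t in 𝓝[>] t₀, ∀ i ∈ s, f i t₀ (ξ t₀) = 0 →
        -(η * a i d₀ * (t - t₀)) ≤ a i (ξ t - ξ t₀) + c i * (t - t₀) := by
      rw [eventually_all_finset]
      intro i hi
      by_cases h0 : f i t₀ (ξ t₀) = 0
      · exact (hlow i hi h0 _ (mul_pos hη (had₀ i hi))).mono fun t ht _ => ht
      · simp [h0]
    filter_upwards [hall, hmem', self_mem_nhdsWithin] with t ht htK htt
    have hpos : 0 < t - t₀ := sub_pos.2 htt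
    -- The difference quotient violates the active linearized constraints by at most `η * a i d₀`,
    -- which adding `η • d₀` compensates exactly.
    have hd : (t - t₀)⁻¹ • (ξ t - ξ t₀) + η • d₀ ∈ feasibleDirections K (ξ t₀) :=
      add_mem_feasibleDirections hK hI
        (smul_mem_feasibleDirections (inv_pos.2 hpos) (sub_mem_feasibleDirections htK))
        (smul_mem_feasibleDirections hη hd₀)
    have hle := hW.1 ⟨_, ⟨hd, fun i hi h0 => ?_⟩, rfl⟩
    · rw [map_add, map_smul, map_smul, smul_eq_mul, smul_eq_mul, map_sub] at hle
      rw [slope_def_field, div_eq_inv_mul]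
      linarith
    · have := mul_le_mul_of_nonneg_left (ht i hi h0) (inv_pos.2 hpos).le
      have e1 : (t - t₀)⁻¹ * -(η * a i d₀ * (t - t₀)) = -(η * a i d₀) := by field_simp
      have e2 : (t - t₀)⁻¹ * (a i (ξ t - ξ t₀) + c i * (t - t₀))
          = (t - t₀)⁻¹ * a i (ξ t - ξ t₀) + c i := by field_simp
      rw [e1, e2] at this
      rw [map_add, map_smul, map_smul, smul_eq_mul, smul_eq_mul]
      linarith
  · intro b hb
    obtain ⟨_, ⟨d, ⟨hdK, hda⟩, rfl⟩, hdb⟩ := (isGLB_lt_iff hW).1 hb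
    obtain ⟨η, hη, hηb⟩ : ∃ η : ℝ, 0 < η ∧ η * ℓ d₀ < b - ℓ d := by
      have : Tendsto (fun η : ℝ => η * ℓ d₀) (𝓝[>] 0) (𝓝 (0 * ℓ d₀)) :=
        ((continuous_id.mul continuous_const).tendsto 0).mono_left nhdsWithin_le_nhds
      obtain ⟨η, h1, h2⟩ := ((this.eventually_lt_const (u := b - ℓ d) (by simpa using hdb)).and
        self_mem_nhdsWithin).exists
      exact ⟨η, h2, h1⟩
    -- Pushing a nearly optimal `d` along `d₀` makes the active constraints grow strictly, so the
    -- straight line in this direction is feasible for the true program for a short time.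
    have hd' : d + η • d₀ ∈ feasibleDirections K (ξ t₀) :=
      add_mem_feasibleDirections hK hI hdK (smul_mem_feasibleDirections hη hd₀)
    have hall : ∀ᶠ t in 𝓝[>] t₀, ∀ i ∈ s, 0 ≤ f i t (ξ t₀ + (t - t₀) • (d + η • d₀)) := by
      rw [eventually_all_finset]
      intro i hi
      refine (hderiv i hi _).eventually_nonneg_right (by simpa using hfeas i hi) fun h0 => ?_
      have h1 := hda i hi (by simpa using h0)
      have h2 := mul_pos hη (had₀ i hi)
      rw [map_add, map_smul, smul_eq_mul]
      linarith
    filter_upwards [hall, hmin', eventually_add_smul_mem hK hI hd' t₀, self_mem_nhdsWithin]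
      with t ht htm htK htt
    have hpos : 0 < t - t₀ := sub_pos.2 htt
    have := htm _ htK ht
    rw [map_add, map_smul, smul_eq_mul, map_add, map_smul, smul_eq_mul] at this
    rw [slope_def_field, div_lt_iff₀ hpos]
    nlinarith

/-- First order optimality: the objective does not decrease along the feasible directions that
strictly increase all constraints. -/
theorem nonneg_of_feasibleDirection {x : E} {f : ι → E → ℝ} (hK : Convex ℝ K) (hx : x ∈ K)
    (hmin : ∀ y ∈ K, (∀ i ∈ s, 0 ≤ f i y) → ℓ x ≤ ℓ y)
    (hfeas : ∀ i ∈ s, 0 ≤ f i x)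
    (hderiv : ∀ i ∈ s, ∀ d, HasDerivWithinAt (fun t : ℝ => f i (x + (t - t₀) • d))
      (a i d) (Ici t₀) t₀)
    {d : E} (hd : d ∈ feasibleDirections K x) (had : ∀ i ∈ s, f i x = 0 → 0 < a i d) :
    0 ≤ ℓ d := by
  have hall : ∀ᶠ t in 𝓝[>] t₀, ∀ i ∈ s, 0 ≤ f i (x + (t - t₀) • d) := by
    rw [eventually_all_finset]
    intro i hi
    exact (hderiv i hi d).eventually_nonneg_right (by simpa using hfeas i hi)
      fun h0 => had i hi (by simpa using h0)
  obtain ⟨t, ⟨ht, htK⟩, htt⟩ :=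
    ((hall.and (eventually_add_smul_mem hK hx hd t₀)).and self_mem_nhdsWithin).exists
  have hpos : 0 < t - t₀ := sub_pos.2 htt
  have := hmin _ htK ht
  rw [map_add, map_smul, smul_eq_mul] at this
  exact nonneg_of_mul_nonneg_right (by linarith) hpos

/-- If all constraints tighten at rates `v i * κ` with `v i > 0`, and the objective can be decreased
along some feasible direction, then the right derivative of the value exists, is nonnegative, and
vanishes only if `κ` does. -/
theorem exists_hasDerivWithinAt_value (hK : Convex ℝ K)
    (hmem : ∀ᶠ t in 𝓝[≥] t₀, ξ t ∈ K)
    (hmin : ∀ᶠ t in 𝓝[≥] t₀, ∀ y ∈ K, (∀ i ∈ s, 0 ≤ f i t y) → ℓ (ξ t) ≤ ℓ y)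
    (hfeas : ∀ i ∈ s, 0 ≤ f i t₀ (ξ t₀))
    {v : ι → ℝ} {κ : ℝ} (hv : ∀ i ∈ s, 0 < v i) (hκ : 0 ≤ κ)
    (hstat : ∀ i ∈ s, ∀ d, HasDerivWithinAt (fun t : ℝ => f i t₀ (ξ t₀ + (t - t₀) • d))
      (a i d) (Ici t₀) t₀)
    (hderiv : ∀ i ∈ s, ∀ d, HasDerivWithinAt (fun t => f i t (ξ t₀ + (t - t₀) • d))
      (a i d + -(v i * κ)) (Ici t₀) t₀)
    (hlow : ∀ i ∈ s, f i t₀ (ξ t₀) = 0 → ∀ ε > 0, ∀ᶠ t in 𝓝[>] t₀,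
      -(ε * (t - t₀)) ≤ a i (ξ t - ξ t₀) + -(v i * κ) * (t - t₀))
    {d₀ : E} (hd₀ : d₀ ∈ feasibleDirections K (ξ t₀)) (had₀ : ∀ i ∈ s, 0 < a i d₀)
    {d₁ : E} (hd₁ : d₁ ∈ feasibleDirections K (ξ t₀)) (hℓd₁ : ℓ d₁ < 0) :
    ∃ W, HasDerivWithinAt (fun t => ℓ (ξ t)) W (Ici t₀) t₀ ∧ 0 ≤ W ∧ (W = 0 ↔ κ = 0) := by
  have hI : ξ t₀ ∈ K := hmem.self_of_nhdsWithin self_mem_Ici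
  set D : Set E := {d ∈ feasibleDirections K (ξ t₀) |
      ∀ i ∈ s, f i t₀ (ξ t₀) = 0 → 0 ≤ a i d + -(v i * κ)} with hD
  have hopt : ∀ d ∈ feasibleDirections K (ξ t₀), (∀ i ∈ s, f i t₀ (ξ t₀) = 0 → 0 < a i d) →
      0 ≤ ℓ d := fun d hd had =>
    nonneg_of_feasibleDirection hK hI (hmin.self_of_nhdsWithin self_mem_Ici) hfeas hstat hd had
  have hnonneg : ∀ d ∈ D, 0 ≤ ℓ d := by
    intro d hd
    have ht : Tendsto (fun η : ℝ => ℓ (d + η • d₀)) (𝓝[>] 0) (𝓝 (ℓ d)) := by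
      have : Continuous fun η : ℝ => ℓ (d + η • d₀) := by fun_prop
      simpa using (this.tendsto 0).mono_left nhdsWithin_le_nhds
    refine ge_of_tendsto ht ?_
    filter_upwards [self_mem_nhdsWithin] with η (hη : 0 < η)
    refine hopt _ (add_mem_feasibleDirections hK hI hd.1 (smul_mem_feasibleDirections hη hd₀))
      fun i hi h0 => ?_
    have h1 := hd.2 i hi h0
    have h2 := mul_pos hη (had₀ i hi)
    have h3 := mul_nonneg (hv i hi).le hκ
    rw [map_add, map_smul, smul_eq_mul]
    linarith
  have hne : D.Nonempty := by
    -- A large multiple of `d₀` outpaces all the tightening rates.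
    have : ∀ᶠ M : ℝ in atTop, ∀ i ∈ s, v i * κ ≤ M * a i d₀ := by
      rw [eventually_all_finset]
      exact fun i hi => (tendsto_id.atTop_mul_const (had₀ i hi)).eventually_ge_atTop _
    obtain ⟨M, hM, hM0⟩ := (this.and (eventually_gt_atTop 0)).exists
    refine ⟨M • d₀, smul_mem_feasibleDirections hM0 hd₀, fun i hi _ => ?_⟩
    rw [map_smul, smul_eq_mul]
    linarith [hM i hi]
  have hW : IsGLB (ℓ '' D) (sInf (ℓ '' D)) :=
    isGLB_csInf (hne.image _) ⟨0, by rintro _ ⟨d, hd, rfl⟩; exact hnonneg d hd⟩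
  have hW0 : 0 ≤ sInf (ℓ '' D) :=
    hW.2 (by rintro _ ⟨d, hd, rfl⟩; exact hnonneg d hd)
  refine ⟨_, hasDerivWithinAt_value hK hmem hmin hfeas hderiv hlow hd₀ had₀ hW, hW0, ?_, ?_⟩
  · intro hz
    by_contra hκ0
    have hκ : 0 < κ := hκ.lt_of_ne' hκ0
    -- The slack `v i * κ` absorbs a tilt by `η • d₁` with `η` independent of `d`, so `-(η * ℓ d₁) >
    -- 0` bounds `ℓ` from below on all of `D`.
    have : ∀ᶠ η : ℝ in 𝓝[>] 0, ∀ i ∈ s, 0 < v i * κ + η * a i d₁ := by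
      rw [eventually_all_finset]
      intro i hi
      have : Continuous fun η : ℝ => v i * κ + η * a i d₁ := by fun_prop
      refine ((this.tendsto 0).mono_left nhdsWithin_le_nhds).eventually_const_lt ?_
      simpa using mul_pos (hv i hi) hκ
    obtain ⟨η, hη, hη0⟩ := (this.and self_mem_nhdsWithin).exists
    have hη0 : 0 < η := hη0
    have : -(η * ℓ d₁) ≤ sInf (ℓ '' D) := by
      refine hW.2 ?_
      rintro _ ⟨d, hd, rfl⟩
      have := hopt (d + η • d₁) (add_mem_feasibleDirections hK hI hd.1
        (smul_mem_feasibleDirections hη0 hd₁)) fun i hi h0 => by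
          have h1 := hd.2 i hi h0
          have h2 := hη i hi
          rw [map_add, map_smul, smul_eq_mul]
          linarith
      rw [map_add, map_smul, smul_eq_mul] at this
      linarith
    nlinarith
  · intro hκ0
    refine le_antisymm (hW.1 ⟨0, ⟨⟨1, one_pos, by simpa using hI⟩, ?_⟩, map_zero ℓ⟩) hW0
    simp [hκ0]

end Sensitivity

/-! ### Unit vectors and the derivative of a distance -/

section Heading

open scoped InnerProductSpace

theorem norm_heading {x y : E3} (h : y ≠ x) : ‖heading x y‖ = 1 :=
  norm_smul_inv_norm (𝕜 := ℝ) (sub_ne_zero.2 h)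

theorem norm_smul_heading {x y : E3} (h : y ≠ x) : ‖y - x‖ • heading x y = y - x := by
  rw [heading, smul_smul, mul_inv_cancel₀ (norm_ne_zero_iff.2 (sub_ne_zero.2 h)), one_smul]

theorem inner_heading_sub {x y : E3} (h : y ≠ x) : ⟪heading x y, y - x⟫_ℝ = ‖y - x‖ := by
  conv_lhs => rw [← norm_smul_heading h]
  rw [real_inner_smul_right, real_inner_self_eq_norm_sq, norm_heading h]
  ring

theorem HasDerivWithinAt.norm_sub_eq_inner_heading {y p : ℝ → E3} {y' p' : E3} {S : Set ℝ} {t : ℝ}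
    (hy : HasDerivWithinAt y y' S t) (hp : HasDerivWithinAt p p' S t) (h : y t ≠ p t) :
    HasDerivWithinAt (fun t => ‖y t - p t‖) ⟪heading (p t) (y t), y' - p'⟫_ℝ S t := by
  have hn : ‖y t - p t‖ ≠ 0 := norm_ne_zero_iff.2 (sub_ne_zero.2 h)
  have := ((hy.sub hp).norm_sq).sqrt (by simpa using sub_ne_zero.2 h)
  simp only [Pi.sub_apply, Real.sqrt_sq (norm_nonneg _)] at this
  convert this using 1
  rw [heading, real_inner_smul_left]
  field_simp

end Heading

/-! ### Concavity and linearization of the potentials -/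

namespace PursuitGame

open scoped InnerProductSpace

variable {Np Ne : ℕ} (G : PursuitGame Np Ne) {i : Fin Np} {j : Fin Ne}

theorem one_lt_ratio' (i : Fin Np) (j : Fin Ne) : 1 < G.ratio i j := G.one_lt_ratio i j

theorem ratio_mul_vE (i : Fin Np) (j : Fin Ne) : G.ratio i j * G.vE j = G.vP i :=
  div_mul_cancel₀ _ (G.vE_pos j).ne'

/-- The difference of squares with the sign of the potential; unlike the potential, it is concave
in `x`. -/
noncomputable def concavePotential (i : Fin Np) (j : Fin Ne) (p e x : E3) : ℝ :=
  ‖x - p‖ ^ 2 - (G.r i + G.ratio i j * ‖x - e‖) ^ 2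

theorem radius_add_nonneg (i : Fin Np) (j : Fin Ne) (e x : E3) :
    0 ≤ G.r i + G.ratio i j * ‖x - e‖ :=
  add_nonneg (G.r_nonneg i)
    (mul_nonneg (zero_le_one.trans (G.one_lt_ratio' i j).le) (norm_nonneg _))

theorem concavePotential_nonneg_iff {p e x : E3} :
    0 ≤ G.concavePotential i j p e x ↔ 0 ≤ G.potential i j p e x := by
  rw [concavePotential, sub_nonneg, sq_le_sq₀ (G.radius_add_nonneg i j e x) (norm_nonneg _),
    potential]
  constructor <;> intro h <;> linarith

theorem concavePotential_pos_iff {p e x : E3} :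
    0 < G.concavePotential i j p e x ↔ 0 < G.potential i j p e x := by
  rw [concavePotential, sub_pos, sq_lt_sq₀ (G.radius_add_nonneg i j e x) (norm_nonneg _),
    potential]
  constructor <;> intro h <;> linarith

/-- The gradient of the concave potential. -/
noncomputable def concaveGradient (i : Fin Np) (j : Fin Ne) (p e x : E3) : E3 :=
  (2 : ℝ) • (x - p) - (2 * G.r i * G.ratio i j) • heading e x - (2 * G.ratio i j ^ 2) • (x - e)

/-- The quadratic part has leading coefficient `1 - α ^ 2 < 0`, which gives the strong concavity
term; the remaining term `-2 r α ‖x - e‖` is concave and lies below its tangent at `x ≠ e`. -/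
theorem concavePotential_le {p e x : E3} (y : E3) (hx : x ≠ e) :
    G.concavePotential i j p e y + (G.ratio i j ^ 2 - 1) * ‖y - x‖ ^ 2 ≤
      G.concavePotential i j p e x + ⟪G.concaveGradient i j p e x, y - x⟫_ℝ := by
  have h1 : ‖y - p‖ ^ 2 = ‖x - p‖ ^ 2 + 2 * ⟪x - p, y - x⟫_ℝ + ‖y - x‖ ^ 2 := by
    rw [← norm_add_sq_real]; congr 2; abel
  have h2 : ‖y - e‖ ^ 2 = ‖x - e‖ ^ 2 + 2 * ⟪x - e, y - x⟫_ℝ + ‖y - x‖ ^ 2 := by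
    rw [← norm_add_sq_real]; congr 2; abel
  have h3 : ‖x - e‖ + ⟪heading e x, y - x⟫_ℝ ≤ ‖y - e‖ := by
    have := real_inner_le_norm (heading e x) (y - e)
    rw [norm_heading hx, one_mul, show y - e = (x - e) + (y - x) by abel, inner_add_right,
      inner_heading_sub hx] at this
    rwa [show (x - e) + (y - x) = y - e by abel] at this
  have h4 : 0 ≤ G.r i * G.ratio i j :=
    mul_nonneg (G.r_nonneg i) (zero_le_one.trans (G.one_lt_ratio' i j).le)
  have h5 := mul_nonneg h4 (sub_nonneg.2 h3)
  simp only [concavePotential, concaveGradient, inner_sub_left (_ - _ : E3) _ (y - x),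
    inner_sub_left ((2 : ℝ) • _ : E3) _ (y - x), real_inner_smul_left]
  linear_combination h1 + 2 * h5 - G.ratio i j ^ 2 * h2

theorem potential_midpoint_pos {p e x y : E3} (hfree : G.r i < ‖e - p‖) (hxy : x ≠ y)
    (hx : 0 ≤ G.potential i j p e x) (hy : 0 ≤ G.potential i j p e y) :
    0 < G.potential i j p e (midpoint ℝ x y) := by
  -- The tangent inequality is not available at the evader, but there the potential is positive by
  -- `hfree`.
  by_cases hm : midpoint ℝ x y = e
  · rw [hm, potential, sub_self, norm_zero]; linarith
  rw [← concavePotential_nonneg_iff] at hx hy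
  rw [← concavePotential_pos_iff]
  have h1 := G.concavePotential_le (i := i) (j := j) (p := p) x hm
  have h2 := G.concavePotential_le (i := i) (j := j) (p := p) y hm
  have h3 : x - midpoint ℝ x y = -(y - midpoint ℝ x y) := by
    rw [left_sub_midpoint, right_sub_midpoint, ← smul_neg, neg_sub]
  have h4 : 0 < ‖y - midpoint ℝ x y‖ := by
    rw [norm_pos_iff, sub_ne_zero]
    exact fun h => hxy ((midpoint_eq_right_iff ℝ).1 h.symm)
  rw [h3, norm_neg, inner_neg_right] at h1
  -- Adding `h1` and `h2` cancels the first order terms and leaves this strict gain.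
  have h5 : 0 < (G.ratio i j ^ 2 - 1) * ‖y - midpoint ℝ x y‖ ^ 2 :=
    mul_pos (by nlinarith [G.one_lt_ratio' i j]) (by positivity)
  linarith

/-- The step has length `θ * ‖x - e‖`: the distance to the pursuer drops by at most that much, while
`α` times the distance to the evader drops by `α` times as much. -/
theorem potential_toward_evader {p e x : E3} {θ : ℝ} (h0 : 0 ≤ θ) (h1 : θ ≤ 1) :
    G.potential i j p e x + θ * ((G.ratio i j - 1) * ‖x - e‖) ≤
      G.potential i j p e (x + θ • (e - x)) := by
  have h2 : ‖x - p‖ ≤ ‖x + θ • (e - x) - p‖ + θ * ‖x - e‖ := by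
    have : x - p = (x + θ • (e - x) - p) + θ • (x - e) := by module
    calc ‖x - p‖ = ‖(x + θ • (e - x) - p) + θ • (x - e)‖ := by rw [← this]
      _ ≤ _ := (norm_add_le _ _).trans_eq (by rw [norm_smul, Real.norm_of_nonneg h0])
  have h3 : ‖x + θ • (e - x) - e‖ = (1 - θ) * ‖x - e‖ := by
    have : x + θ • (e - x) - e = (1 - θ) • (x - e) := by module
    rw [this, norm_smul, Real.norm_of_nonneg (by linarith)]
  simp only [potential]
  rw [h3]
  linarith

theorem tendsto_potential {X : Type*} {l : Filter X} {p e x : X → E3} {p₀ e₀ x₀ : E3}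
    (hp : Tendsto p l (𝓝 p₀)) (he : Tendsto e l (𝓝 e₀)) (hx : Tendsto x l (𝓝 x₀)) :
    Tendsto (fun z => G.potential i j (p z) (e z) (x z)) l (𝓝 (G.potential i j p₀ e₀ x₀)) :=
  ((hx.sub hp).norm.sub ((hx.sub he).norm.const_mul (G.ratio i j))).sub_const (G.r i)

/-- The gradient of the potential in `x`, as a linear form. -/
noncomputable def potentialGradient (i : Fin Np) (j : Fin Ne) (p e x : E3) : E3 →L[ℝ] ℝ :=
  innerSL ℝ (heading p x - G.ratio i j • heading e x)

theorem potentialGradient_apply (p e x d : E3) :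
    G.potentialGradient i j p e x d =
      ⟪heading p x, d⟫_ℝ - G.ratio i j * ⟪heading e x, d⟫_ℝ := by
  rw [potentialGradient, innerSL_apply_apply, inner_sub_left, real_inner_smul_left]

theorem potentialGradient_toward_evader_pos {p e x : E3} (hp : x ≠ p) (he : x ≠ e) :
    0 < G.potentialGradient i j p e x (e - x) := by
  have h1 := neg_le_of_abs_le (abs_real_inner_le_norm (heading p x) (e - x))
  rw [norm_heading hp, one_mul, norm_sub_rev] at h1
  rw [potentialGradient_apply, ← neg_sub x e, inner_neg_right _ (x - e),
    inner_neg_right (heading e x), inner_heading_sub he]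
  rw [← neg_sub x e, inner_neg_right] at h1
  have h2 : 0 < ‖x - e‖ := norm_pos_iff.2 (sub_ne_zero.2 he)
  nlinarith [G.one_lt_ratio' i j]

theorem hasDerivWithinAt_potential {p e y : ℝ → E3} {p' e' y' : E3} {S : Set ℝ} {t : ℝ}
    (hp : HasDerivWithinAt p p' S t) (he : HasDerivWithinAt e e' S t)
    (hy : HasDerivWithinAt y y' S t) (hyp : y t ≠ p t) (hye : y t ≠ e t) :
    HasDerivWithinAt (fun t => G.potential i j (p t) (e t) (y t))
      (G.potentialGradient i j (p t) (e t) (y t) y' +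
        (G.ratio i j * ⟪heading (e t) (y t), e'⟫_ℝ - ⟪heading (p t) (y t), p'⟫_ℝ)) S t := by
  have h1 := hy.norm_sub_eq_inner_heading hp hyp
  have h2 := hy.norm_sub_eq_inner_heading he hye
  have := (h1.sub (h2.const_mul (G.ratio i j))).sub_const (G.r i)
  refine this.congr_deriv ?_
  rw [potentialGradient_apply, inner_sub_right, inner_sub_right]
  ring

/-- The concave potential is the potential times `‖x - p‖ + (r + α * ‖x - e‖)`. On the zero set this
factor equals `2 * ‖x - p‖`, and the derivative of the factor does not contribute. -/
theorem concaveGradient_eq {p e x : E3} (hp : x ≠ p) (he : x ≠ e)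
    (h0 : G.potential i j p e x = 0) (d : E3) :
    ⟪G.concaveGradient i j p e x, d⟫_ℝ =
      2 * ‖x - p‖ * G.potentialGradient i j p e x d := by
  have h1 : ‖x - p‖ = G.r i + G.ratio i j * ‖x - e‖ := by
    rw [potential] at h0; linarith
  have h2 : ⟪x - p, d⟫_ℝ = ‖x - p‖ * ⟪heading p x, d⟫_ℝ := by
    rw [← real_inner_smul_left, norm_smul_heading hp]
  have h3 : ⟪x - e, d⟫_ℝ = ‖x - e‖ * ⟪heading e x, d⟫_ℝ := by
    rw [← real_inner_smul_left, norm_smul_heading he]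
  simp only [concaveGradient, inner_sub_left (_ - _ : E3) _ d,
    inner_sub_left ((2 : ℝ) • _ : E3) _ d, real_inner_smul_left, potentialGradient_apply, h2, h3]
  linear_combination 2 * G.ratio i j * ⟪heading e x, d⟫_ℝ * h1

theorem hasDerivWithinAt_concavePotential {p e : ℝ → E3} {p' e' x : E3} {S : Set ℝ} {t : ℝ}
    (hp : HasDerivWithinAt p p' S t) (he : HasDerivWithinAt e e' S t)
    (hxp : x ≠ p t) (hxe : x ≠ e t) :
    HasDerivWithinAt (fun t => G.concavePotential i j (p t) (e t) x)
      (2 * (G.r i + G.ratio i j * ‖x - e t‖) * (G.ratio i j * ⟪heading (e t) x, e'⟫_ℝ) -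
        2 * ‖x - p t‖ * ⟪heading (p t) x, p'⟫_ℝ) S t := by
  have hx : HasDerivWithinAt (fun _ : ℝ => x) 0 S t := hasDerivWithinAt_const _ _ _
  have h1 := (hx.norm_sub_eq_inner_heading hp hxp).pow 2
  have h2 := (((hx.norm_sub_eq_inner_heading he hxe).const_mul (G.ratio i j)).const_add
    (G.r i)).pow 2
  refine (h1.sub h2).congr_deriv ?_
  simp only [zero_sub, inner_neg_right]
  push_cast
  ring

theorem differentiableWithinAt_concaveGradient {p e : ℝ → E3} {x : E3} {S : Set ℝ} {t : ℝ}
    (hp : DifferentiableWithinAt ℝ p S t) (he : DifferentiableWithinAt ℝ e S t) (hxe : x ≠ e t) :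
    DifferentiableWithinAt ℝ (fun t => G.concaveGradient i j (p t) (e t) x) S t := by
  have h1 : DifferentiableWithinAt ℝ (fun t => x - e t) S t := he.const_sub x
  have h2 : DifferentiableWithinAt ℝ (fun t => x - p t) S t := hp.const_sub x
  have h3 : DifferentiableWithinAt ℝ (fun t => heading (e t) x) S t :=
    ((h1.norm ℝ (sub_ne_zero.2 hxe)).inv (norm_ne_zero_iff.2 (sub_ne_zero.2 hxe))).smul h1
  exact ((h2.const_smul (2 : ℝ)).sub (h3.const_smul (2 * G.r i * G.ratio i j))).sub
    (h1.const_smul (2 * G.ratio i j ^ 2))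

/-- Nearby points at which the moving potential is nonnegative satisfy the linearized constraint up
to an error of smaller order in time, however slowly they converge. -/
theorem eventually_linearized {p e ξ : ℝ → E3} {p' e' x : E3} {t₀ : ℝ}
    (hp : HasDerivWithinAt p p' (Ici t₀) t₀) (he : HasDerivWithinAt e e' (Ici t₀) t₀)
    (hxp : x ≠ p t₀) (hxe : x ≠ e t₀) (h0 : G.potential i j (p t₀) (e t₀) x = 0)
    (hξ : Tendsto ξ (𝓝[>] t₀) (𝓝 x))
    (hpos : ∀ᶠ t in 𝓝[>] t₀, 0 ≤ G.potential i j (p t) (e t) (ξ t)) {ε : ℝ} (hε : 0 < ε) :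
    ∀ᶠ t in 𝓝[>] t₀, -(ε * (t - t₀)) ≤ G.potentialGradient i j (p t₀) (e t₀) x (ξ t - x) +
      (G.ratio i j * ⟪heading (e t₀) x, e'⟫_ℝ - ⟪heading (p t₀) x, p'⟫_ℝ) * (t - t₀) := by
  set c := G.ratio i j * ⟪heading (e t₀) x, e'⟫_ℝ - ⟪heading (p t₀) x, p'⟫_ℝ with hc
  have hρ : 0 < ‖x - p t₀‖ := norm_pos_iff.2 (sub_ne_zero.2 hxp)
  have h1 : ‖x - p t₀‖ = G.r i + G.ratio i j * ‖x - e t₀‖ := by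
    rw [potential] at h0; linarith
  have hΦ : HasDerivWithinAt (fun t => G.concavePotential i j (p t) (e t) x)
      (2 * ‖x - p t₀‖ * c) (Ici t₀) t₀ :=
    (G.hasDerivWithinAt_concavePotential hp he hxp hxe).congr_deriv (by rw [← h1, hc]; ring)
  have hΦ0 : G.concavePotential i j (p t₀) (e t₀) x = 0 := by
    rw [concavePotential, h1]; ring
  have hL := (G.differentiableWithinAt_concaveGradient (i := i) (j := j) hp.differentiableWithinAt
    he.differentiableWithinAt hxe).hasDerivWithinAt
  have hΦs := (hasDerivWithinAt_iff_tendsto_slope' (by simp)).1 hΦ.Ioi_of_Ici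
  have hLs := (hasDerivWithinAt_iff_tendsto_slope' (by simp)).1 hL.Ioi_of_Ici
  -- The change of the gradient is `O(t - t₀)` and is paired with `ξ t - x → 0`, so its contribution
  -- is `o(t - t₀)` however slow the convergence is.
  have hsum := hΦs.add (hLs.inner (hξ.sub_const x) (𝕜 := ℝ))
  rw [sub_self, inner_zero_right, add_zero] at hsum
  have hlt : 2 * ‖x - p t₀‖ * c < 2 * ‖x - p t₀‖ * (c + ε) :=
    mul_lt_mul_of_pos_left (by linarith) (by positivity)
  have hxe' : ∀ᶠ t in 𝓝[>] t₀, x ≠ e t :=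
    ((he.continuousWithinAt.mono Ioi_subset_Ici_self).eventually_ne hxe.symm).mono
      fun t ht => ht.symm
  filter_upwards [hsum.eventually_lt_const hlt, hpos, hxe', self_mem_nhdsWithin]
    with t ht htp hte htt
  have hτ : 0 < t - t₀ := sub_pos.2 htt
  rw [← concavePotential_nonneg_iff] at htp
  have h2 := G.concavePotential_le (i := i) (j := j) (p := p t) (ξ t) hte
  have h3 : 0 ≤ (G.ratio i j ^ 2 - 1) * ‖ξ t - x‖ ^ 2 :=
    mul_nonneg (by nlinarith [G.one_lt_ratio' i j]) (by positivity)
  have h4 := mul_lt_mul_of_pos_left ht hτ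
  have h5 := G.concaveGradient_eq hxp hxe h0 (ξ t - x)
  rw [slope_def_field, slope_def_module, real_inner_smul_left, inner_sub_left, h5, hΦ0, sub_zero,
    mul_add, ← mul_assoc (t - t₀) (t - t₀)⁻¹, mul_inv_cancel₀ hτ.ne', one_mul,
    mul_div_cancel₀ _ hτ.ne'] at h4
  have h6 : 0 < ‖x - p t₀‖ * (G.potentialGradient i j (p t₀) (e t₀) x (ξ t - x) +
      c * (t - t₀) + ε * (t - t₀)) := by nlinarith
  have := (mul_pos_iff_of_pos_left hρ).1 h6
  linarith

end PursuitGame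

/-! ### Convexity and compactness of the play region -/

namespace PlayRegion

variable (R : PlayRegion)

theorem convex_region : Convex ℝ R.region := by
  have h : Convex ℝ {x : E3 | 0 ≤ x 2} := by
    intro x hx y hy a b ha hb _
    simp only [mem_ofPred_eq, PiLp.add_apply, PiLp.smul_apply, smul_eq_mul] at hx hy ⊢
    positivity
  exact h.inter R.convex_g

theorem isCompact_region : IsCompact R.region := by
  refine Metric.isCompact_of_isClosed_isBounded ?_ R.bounded
  exact (isClosed_le (g := fun x : E3 => x 2) continuous_const (by fun_prop)).inter
    (isClosed_le continuous_const R.differentiable_g.continuous)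

theorem isCompact_exit : IsCompact R.exit :=
  R.isCompact_region.inter_right (t := {x : E3 | x 2 = 0})
    (isClosed_eq (f := fun x : E3 => x 2) (by fun_prop) continuous_const)

theorem exists_mem_exit : ∃ q, q ∈ R.exit := by
  obtain ⟨q, h0, hg⟩ := R.exit_nonempty
  exact ⟨q, ⟨h0.ge, hg⟩, h0⟩

end PlayRegion

/-! ### Existence, uniqueness and continuity of the interception point -/

namespace PursuitGame

variable {Np Ne : ℕ} (G : PursuitGame Np Ne) {R : PlayRegion} {s : Finset (Fin Np)} {j : Fin Ne}
  {p : Fin Np → E3} {e : E3}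

theorem isInterceptionPoint_iff (hfree : ∀ i ∈ s, G.r i < ‖e - p i‖) {x : E3} :
    G.IsInterceptionPoint R s j p e x ↔
      (x ∈ R.region ∧ ∀ i ∈ s, 0 ≤ G.potential i j (p i) e x) ∧
        ∀ y ∈ R.region, (∀ i ∈ s, 0 ≤ G.potential i j (p i) e y) → x 2 ≤ y 2 := by
  simp only [IsInterceptionPoint, G.closedEvasionSpace_eq s j p e hfree, mem_inter_iff,
    mem_ofPred_eq, and_imp]
  exact ⟨fun h => ⟨h.1.symm, fun y h1 h2 => h.2 y h2 h1⟩,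
    fun h => ⟨h.1.symm, fun y h1 h2 => h.2 y h2 h1⟩⟩

/-- A point of the play region off the exit at which all potentials are positive does not minimize
the height. -/
theorem exists_lower {x : E3} (hx : x ∈ R.region) (hx2 : 0 < x 2)
    (hpos : ∀ i ∈ s, 0 < G.potential i j (p i) e x) :
    ∃ y ∈ R.region, (∀ i ∈ s, 0 ≤ G.potential i j (p i) e y) ∧ y 2 < x 2 := by
  obtain ⟨q, hq, hq0⟩ := R.exists_mem_exit
  have hc : ∀ᶠ θ : ℝ in 𝓝[>] 0, ∀ i ∈ s, 0 < G.potential i j (p i) e (x + θ • (q - x)) := by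
    rw [eventually_all_finset]
    intro i hi
    have hx : Tendsto (fun θ : ℝ => x + θ • (q - x)) (𝓝[>] 0) (𝓝 x) := by
      have : Continuous fun θ : ℝ => x + θ • (q - x) := by fun_prop
      simpa using (this.tendsto 0).mono_left nhdsWithin_le_nhds
    exact (G.tendsto_potential tendsto_const_nhds tendsto_const_nhds hx).eventually_const_lt
      (hpos i hi)
  obtain ⟨θ, hθ, h0, h1⟩ := (hc.and (Ioo_mem_nhdsGT one_pos)).exists
  refine ⟨_, R.convex_region.add_smul_sub_mem hx hq ⟨h0.le, h1.le⟩, fun i hi => (hθ i hi).le, ?_⟩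
  simp only [PiLp.add_apply, PiLp.smul_apply, PiLp.sub_apply, hq0, smul_eq_mul]
  nlinarith

theorem pos_of_mem_region (hmiss : ∀ x ∈ R.exit, ∃ i ∈ s, G.potential i j (p i) e x < 0) {x : E3}
    (hx : x ∈ R.region) (hpos : ∀ i ∈ s, 0 ≤ G.potential i j (p i) e x) : 0 < x 2 := by
  refine hx.1.lt_of_ne' fun h0 => ?_
  obtain ⟨i, hi, hlt⟩ := hmiss x ⟨hx, h0⟩
  exact (hpos i hi).not_gt hlt

/-- Compactness gives a minimizer. The midpoint of two minimizers would have the same height and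
positive potentials, so it could be lowered by moving towards the exit. -/
theorem existsUnique_isInterceptionPoint (hfree : ∀ i ∈ s, G.r i < ‖e - p i‖)
    (hne : ∃ x ∈ R.region, ∀ i ∈ s, 0 ≤ G.potential i j (p i) e x)
    (hmiss : ∀ x ∈ R.exit, ∃ i ∈ s, G.potential i j (p i) e x < 0) :
    ∃! x, G.IsInterceptionPoint R s j p e x := by
  simp only [G.isInterceptionPoint_iff hfree]
  have hclosed : IsClosed {x | ∀ i ∈ s, 0 ≤ G.potential i j (p i) e x} := by
    rw [← G.closedEvasionSpace_eq s j p e hfree]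
    exact isClosed_closure
  obtain ⟨x, ⟨hx, hxpos⟩, hmin⟩ := (R.isCompact_region.inter_right hclosed).exists_isMinOn hne
    (f := fun x : E3 => x 2) (by fun_prop)
  have hmin' : ∀ y ∈ R.region, (∀ i ∈ s, 0 ≤ G.potential i j (p i) e y) → x 2 ≤ y 2 :=
    fun y hy hypos => hmin ⟨hy, hypos⟩
  refine ⟨x, ⟨⟨hx, hxpos⟩, hmin'⟩, ?_⟩
  rintro y ⟨⟨hy, hypos⟩, hymin⟩
  by_contra hyx
  have hm : midpoint ℝ y x ∈ R.region := R.convex_region.midpoint_mem hy hx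
  have hmpos : ∀ i ∈ s, 0 < G.potential i j (p i) e (midpoint ℝ y x) := fun i hi =>
    G.potential_midpoint_pos (hfree i hi) hyx (hypos i hi) (hxpos i hi)
  obtain ⟨z, hz, hzpos, hlt⟩ := G.exists_lower hm
    (G.pos_of_mem_region hmiss hm fun i hi => (hmpos i hi).le) hmpos
  have h1 := hmin' z hz hzpos
  have h2 := hymin x hx hxpos
  have h3 : midpoint ℝ y x 2 = (y 2 + x 2) / 2 := by
    rw [midpoint_eq_smul_add]
    simp only [PiLp.smul_apply, PiLp.add_apply, smul_eq_mul, invOf_eq_inv]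
    ring
  linarith

theorem isInterceptionPoint_interceptionPoint
    (h : ∃ x, G.IsInterceptionPoint R s j p e x) :
    G.IsInterceptionPoint R s j p e (G.interceptionPoint R s j p e) :=
  Classical.epsilon_spec h

theorem IsInterceptionPoint.ne_evader {x : E3} (hfree : ∀ i ∈ s, G.r i < ‖e - p i‖)
    (hmiss : ∀ x ∈ R.exit, ∃ i ∈ s, G.potential i j (p i) e x < 0)
    (h : G.IsInterceptionPoint R s j p e x) : x ≠ e := by
  rintro rfl
  obtain ⟨⟨hx, hpos⟩, hmin⟩ := (G.isInterceptionPoint_iff hfree).1 h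
  obtain ⟨y, hy, hypos, hlt⟩ := G.exists_lower (s := s) (j := j) (p := p) (e := x) hx
    (G.pos_of_mem_region hmiss hx hpos) fun i hi => by
      have := hfree i hi
      rw [potential, sub_self, norm_zero]
      linarith
  exact (hmin y hy hypos).not_gt hlt

theorem ne_pursuer_of_potential_nonneg {i : Fin Np} {p e x : E3} (hfree : G.r i < ‖e - p‖)
    (h : 0 ≤ G.potential i j p e x) : x ≠ p := by
  rintro rfl
  rw [potential, sub_self, norm_zero, norm_sub_rev] at h
  have h1 := G.one_lt_ratio' i j
  have h2 := G.r_nonneg i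
  nlinarith

section Motion

variable {l : Filter ℝ} {xP : Fin Np → ℝ → E3} {xE : ℝ → E3}

theorem eventually_free (hP : ∀ i ∈ s, Tendsto (xP i) l (𝓝 (p i))) (hE : Tendsto xE l (𝓝 e))
    (hfree : ∀ i ∈ s, G.r i < ‖e - p i‖) :
    ∀ᶠ t in l, ∀ i ∈ s, G.r i < ‖xE t - xP i t‖ := by
  rw [eventually_all_finset]
  exact fun i hi => ((hE.sub (hP i hi)).norm).eventually_const_lt (hfree i hi)

theorem eventually_potential_pos (hP : ∀ i ∈ s, Tendsto (xP i) l (𝓝 (p i)))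
    (hE : Tendsto xE l (𝓝 e)) {x : E3} (hpos : ∀ i ∈ s, 0 < G.potential i j (p i) e x) :
    ∀ᶠ t in l, ∀ i ∈ s, 0 < G.potential i j (xP i t) (xE t) x := by
  rw [eventually_all_finset]
  exact fun i hi => (G.tendsto_potential (hP i hi) hE tendsto_const_nhds).eventually_const_lt (hpos i hi)

theorem eventually_existsUnique_isInterceptionPoint
    (hP : ∀ i ∈ s, Tendsto (xP i) l (𝓝 (p i))) (hE : Tendsto xE l (𝓝 e))
    (hfree : ∀ i ∈ s, G.r i < ‖e - p i‖) (hplay : e ∈ R.region)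
    (hmiss : ∀ x ∈ R.exit, ∃ i ∈ s, G.potential i j (p i) e x < 0) :
    ∀ᶠ t in l, ∃! x, G.IsInterceptionPoint R s j (fun i => xP i t) (xE t) x := by
  have hpos : ∀ i ∈ s, 0 < G.potential i j (p i) e e := fun i hi => by
    rw [potential, sub_self, norm_zero]
    linarith [hfree i hi]
  have hmiss' : ∀ᶠ t in l, ∀ x ∈ R.exit, ∃ i ∈ s, G.potential i j (xP i t) (xE t) x < 0 := by
    -- Tube lemma: strict violation is open in time and position, hence uniform over the compact
    -- exit.
    have := R.isCompact_exit.mem_prod_nhdsSet_of_forall (l := l)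
      (s := {z | ∃ i ∈ s, G.potential i j (xP i z.1) (xE z.1) z.2 < 0}) fun x hx => by
        obtain ⟨i, hi, hlt⟩ := hmiss x hx
        exact ((G.tendsto_potential ((hP i hi).comp tendsto_fst) (hE.comp tendsto_fst)
            tendsto_snd).eventually_lt_const hlt).mono
          fun z hz => ⟨i, hi, hz⟩
    exact (Filter.Eventually.curry this).mono fun t ht => ht.self_of_nhdsSet
  filter_upwards [hmiss', G.eventually_free hP hE hfree, G.eventually_potential_pos hP hE hpos]
    with t h1 h2 h3
  exact G.existsUnique_isInterceptionPoint h2 ⟨e, hplay, fun i hi => (h3 i hi).le⟩ h1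

/-- Interception points depend continuously on the positions of the players. -/
theorem tendsto_isInterceptionPoint {x : E3} {ξ : ℝ → E3}
    (hP : ∀ i ∈ s, Tendsto (xP i) l (𝓝 (p i))) (hE : Tendsto xE l (𝓝 e))
    (hfree : ∀ i ∈ s, G.r i < ‖e - p i‖) (hplay : e ∈ R.region)
    (hmiss : ∀ x ∈ R.exit, ∃ i ∈ s, G.potential i j (p i) e x < 0)
    (hx : G.IsInterceptionPoint R s j p e x)
    (hξ : ∀ᶠ t in l, G.IsInterceptionPoint R s j (fun i => xP i t) (xE t) (ξ t)) :
    Tendsto ξ l (𝓝 x) := by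
  have hxe : x ≠ e := IsInterceptionPoint.ne_evader G hfree hmiss hx
  have huniq := G.existsUnique_isInterceptionPoint hfree ⟨x, ((G.isInterceptionPoint_iff
    hfree).1 hx).1⟩ hmiss
  have hx' := hx
  rw [G.isInterceptionPoint_iff hfree] at hx
  obtain ⟨⟨hxR, hxpos⟩, hmin⟩ := hx
  rw [tendsto_nhds]
  intro U hU hxU
  have hK : IsCompact (R.region \ U) := R.isCompact_region.diff hU
  -- Each point outside `U` is ruled out by a condition stable near it and for nearby times: it
  -- violates a constraint, or it is higher than some strictly feasible point. The latter is found
  -- slightly off `x` towards the evader, since by uniqueness a feasible `y ∉ U` is strictly higher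
  -- than `x`.
  have := hK.mem_prod_nhdsSet_of_forall (l := l)
    (s := {z | (∃ i ∈ s, G.potential i j (xP i z.1) (xE z.1) z.2 < 0) ∨
      ∃ y ∈ R.region, (∀ i ∈ s, 0 < G.potential i j (xP i z.1) (xE z.1) y) ∧ y 2 < z.2 2})
    fun y hy => by
      by_cases hyf : ∃ i ∈ s, G.potential i j (p i) e y < 0
      · obtain ⟨i, hi, hlt⟩ := hyf
        exact ((G.tendsto_potential ((hP i hi).comp tendsto_fst) (hE.comp tendsto_fst)
            tendsto_snd).eventually_lt_const hlt).mono
          fun z hz => Or.inl ⟨i, hi, hz⟩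
      · push Not at hyf
        have hlt : x 2 < y 2 := by
          refine (hmin y hy.1 hyf).lt_of_ne fun h => hy.2 ?_
          have : G.IsInterceptionPoint R s j p e y := by
            rw [G.isInterceptionPoint_iff hfree]
            exact ⟨⟨hy.1, hyf⟩, h ▸ hmin⟩
          rwa [huniq.unique this hx']
        obtain ⟨θ, hθ, h0, h1⟩ : ∃ θ : ℝ, (x + θ • (e - x)) 2 < y 2 ∧ 0 < θ ∧ θ < 1 := by
          have hc : Continuous fun θ : ℝ => (x + θ • (e - x)) 2 := by fun_prop
          have := ((hc.tendsto 0).mono_left (nhdsWithin_le_nhds (s := Ioi 0))).eventually_lt_const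
            (u := y 2) (by simpa using hlt)
          exact (this.and (Ioo_mem_nhdsGT one_pos)).exists
        have hpos : ∀ i ∈ s, 0 < G.potential i j (p i) e (x + θ • (e - x)) := fun i hi => by
          have h2 := G.potential_toward_evader (i := i) (j := j) (p := p i) (e := e) (x := x)
            h0.le h1.le
          have h3 : 0 < ‖x - e‖ := norm_pos_iff.2 (sub_ne_zero.2 hxe)
          have h4 := mul_pos h0 (mul_pos (sub_pos.2 (G.one_lt_ratio' i j)) h3)
          linarith [hxpos i hi]
        have hc : Continuous fun z : E3 => z 2 := by fun_prop
        filter_upwards [(G.eventually_potential_pos hP hE hpos).prod_inl (𝓝 y),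
          ((hc.tendsto y).eventually_const_lt hθ).prod_inr l] with z hz1 hz2
        exact Or.inr ⟨_, R.convex_region.add_smul_sub_mem hxR hplay ⟨h0.le, h1.le⟩, hz1, hz2⟩
  filter_upwards [hξ, (Filter.Eventually.curry this).mono fun t ht => ht.self_of_nhdsSet,
    G.eventually_free hP hE hfree] with t ht h1 hf
  obtain ⟨⟨h2, h3⟩, h4⟩ := (G.isInterceptionPoint_iff hf).1 ht
  by_contra hU
  rcases h1 _ ⟨h2, hU⟩ with ⟨i, hi, hlt⟩ | ⟨y, hy, hypos, hlt⟩
  · exact (h3 i hi).not_gt hlt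
  · exact (h4 y hy fun i hi => (hypos i hi).le).not_gt hlt

end Motion

end PursuitGame

/-! ### The main theorem -/

open scoped InnerProductSpace in
theorem mainTheorem9 {Np Ne : ℕ} (G : PursuitGame Np Ne) (R : PlayRegion)
    (s : Finset (Fin Np)) (hs : s.Nonempty) (j : Fin Ne)
    (xP : Fin Np → ℝ → E3) (xE : Fin Ne → ℝ → E3) (t₀ : ℝ)
    (hfree : ∀ i ∈ s, G.r i < ‖xE j t₀ - xP i t₀‖)
    (hplay : xE j t₀ ∈ R.region)
    (hmiss : G.closedEvasionSpace s j (fun i => xP i t₀) (xE j t₀) ∩ R.exit = ∅)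
    (hpursuers : ∀ i ∈ s, MovesWithHeading (G.vP i) (xP i)
      (heading (xP i t₀) (G.interceptionPoint R s j (fun i => xP i t₀) (xE j t₀))) t₀)
    (uE : E3) (hevader : MovesWithHeading (G.vE j) (xE j) uE t₀) :
    -- the interception point is well defined at `t₀` and right after `t₀`, and so are the headings
    (∀ᶠ t in 𝓝[≥] t₀,
      ∃! x, G.IsInterceptionPoint R s j (fun i => xP i t) (xE j t) x) ∧
    (∀ i ∈ s, G.interceptionPoint R s j (fun i => xP i t₀) (xE j t₀) ≠ xP i t₀) ∧
    G.interceptionPoint R s j (fun i => xP i t₀) (xE j t₀) ≠ xE j t₀ ∧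
    -- the rate of change of the height of the interception point
    ∃ zdot : ℝ,
      HasDerivWithinAt
        (fun t => G.interceptionPoint R s j (fun i => xP i t) (xE j t) 2) zdot (Ici t₀) t₀ ∧
      0 ≤ zdot ∧
      (zdot = 0 ↔
        uE = heading (xE j t₀) (G.interceptionPoint R s j (fun i => xP i t₀) (xE j t₀))) := by
  have hmiss' : ∀ x ∈ R.exit, ∃ i ∈ s, G.potential i j (xP i t₀) (xE j t₀) x < 0 := by
    intro x hx
    by_contra! h
    rw [G.closedEvasionSpace_eq s j (fun i => xP i t₀) (xE j t₀) hfree] at hmiss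
    exact notMem_empty x (hmiss ▸ ⟨h, hx⟩)
  have hP : ∀ i ∈ s, Tendsto (xP i) (𝓝[≥] t₀) (𝓝 (xP i t₀)) := fun i hi =>
    (hpursuers i hi).2.continuousWithinAt
  have hE : Tendsto (xE j) (𝓝[≥] t₀) (𝓝 (xE j t₀)) := hevader.2.continuousWithinAt
  have hex := G.eventually_existsUnique_isInterceptionPoint (p := fun i => xP i t₀) hP hE hfree
    hplay hmiss'
  set ξ : ℝ → E3 := fun t => G.interceptionPoint R s j (fun i => xP i t) (xE j t)
  have hξ : ∀ᶠ t in 𝓝[≥] t₀, G.IsInterceptionPoint R s j (fun i => xP i t) (xE j t) (ξ t) :=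
    hex.mono fun t ht => G.isInterceptionPoint_interceptionPoint ht.exists
  have hξ' : ∀ᶠ t in 𝓝[≥] t₀, (ξ t ∈ R.region ∧
      ∀ i ∈ s, 0 ≤ G.potential i j (xP i t) (xE j t) (ξ t)) ∧
      ∀ y ∈ R.region, (∀ i ∈ s, 0 ≤ G.potential i j (xP i t) (xE j t) y) → ξ t 2 ≤ y 2 := by
    filter_upwards [hξ, G.eventually_free (p := fun i => xP i t₀) hP hE hfree] with t ht hf
    exact (G.isInterceptionPoint_iff hf).1 ht
  have hξ₀ := hξ.self_of_nhdsWithin self_mem_Ici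
  obtain ⟨⟨hIR, hIpos⟩, -⟩ := hξ'.self_of_nhdsWithin self_mem_Ici
  have hIe : ξ t₀ ≠ xE j t₀ := PursuitGame.IsInterceptionPoint.ne_evader G hfree hmiss' hξ₀
  have hIp : ∀ i ∈ s, ξ t₀ ≠ xP i t₀ := fun i hi =>
    G.ne_pursuer_of_potential_nonneg (hfree i hi) (hIpos i hi)
  have htend := (G.tendsto_isInterceptionPoint hP hE hfree hplay hmiss' hξ₀ hξ).mono_left
    (nhdsWithin_mono t₀ Ioi_subset_Ici_self)
  have hnE : ‖heading (xE j t₀) (ξ t₀)‖ = 1 := norm_heading hIe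
  obtain ⟨q, hq, hq0⟩ := R.exists_mem_exit
  have hI2 : 0 < ξ t₀ 2 := G.pos_of_mem_region hmiss' hIR hIpos
  -- Since `α * vE = vP`, all constraints tighten in proportion to `vP i` with the same factor,
  -- which depends only on the evader's heading.
  have hrate : ∀ i ∈ s,
      G.ratio i j * ⟪heading (xE j t₀) (ξ t₀), G.vE j • uE⟫_ℝ -
        ⟪heading (xP i t₀) (ξ t₀), G.vP i • heading (xP i t₀) (ξ t₀)⟫_ℝ =
      -(G.vP i * (1 - ⟪heading (xE j t₀) (ξ t₀), uE⟫_ℝ)) := fun i hi => by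
    rw [real_inner_smul_right, real_inner_smul_right, real_inner_self_eq_norm_sq,
      norm_heading (hIp i hi), ← G.ratio_mul_vE i j]
    ring
  have hline : ∀ d : E3, HasDerivWithinAt (fun t : ℝ => ξ t₀ + (t - t₀) • d) d (Ici t₀) t₀ :=
    fun d => by
      simpa using ((((hasDerivWithinAt_id t₀ (Ici t₀)).sub_const t₀).smul_const d).const_add
        (ξ t₀))
  have hline₀ : ∀ d : E3, ξ t₀ + (t₀ - t₀) • d = ξ t₀ := fun d => by simp
  have hκ : 0 ≤ 1 - ⟪heading (xE j t₀) (ξ t₀), uE⟫_ℝ := by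
    have := real_inner_le_norm (heading (xE j t₀) (ξ t₀)) uE
    rw [hnE, hevader.1] at this
    linarith
  obtain ⟨W, hW, hW0, hiff⟩ := exists_hasDerivWithinAt_value (s := s) (K := R.region)
    (ℓ := EuclideanSpace.proj (2 : Fin 3))
    (f := fun i t x => G.potential i j (xP i t) (xE j t) x) (ξ := ξ) (t₀ := t₀)
    (a := fun i => G.potentialGradient i j (xP i t₀) (xE j t₀) (ξ t₀)) (v := G.vP)
    R.convex_region (hξ'.mono fun t ht => ht.1.1) (hξ'.mono fun t ht => ht.2) hIpos
    (fun i _ => G.vP_pos i) hκ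
    -- The derivative with frozen players is the moving one with zero velocities.
    (fun i hi d => by
      have := G.hasDerivWithinAt_potential (i := i) (j := j)
        (hasDerivWithinAt_const t₀ (Ici t₀) (xP i t₀))
        (hasDerivWithinAt_const t₀ (Ici t₀) (xE j t₀)) (hline d)
        (by simpa using hIp i hi) (by simpa using hIe)
      simpa [hline₀] using this)
    (fun i hi d => by
      have := G.hasDerivWithinAt_potential (i := i) (j := j) (hpursuers i hi).2 hevader.2 (hline d)
        (by simpa using hIp i hi) (by simpa using hIe)
      rw [hline₀] at this
      rwa [← hrate i hi])
    (fun i hi h0 ε hε => by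
      have := G.eventually_linearized (hpursuers i hi).2 hevader.2 (hIp i hi) hIe h0 htend
        ((hξ'.filter_mono (nhdsWithin_mono t₀ Ioi_subset_Ici_self)).mono
          fun t ht => ht.1.2 i hi) hε
      rwa [hrate i hi] at this)
    (sub_mem_feasibleDirections hplay)
    (fun i hi => G.potentialGradient_toward_evader_pos (hIp i hi) hIe)
    -- Any exit point gives a direction of descent, because the interception point lies strictly
    -- above the exit plane.
    (sub_mem_feasibleDirections hq)
    (by
      rw [map_sub]
      change q 2 - ξ t₀ 2 < 0
      linarith)
  refine ⟨hex, hIp, hIe, W, hW, hW0, hiff.trans ?_⟩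
  rw [sub_eq_zero, eq_comm (a := (1 : ℝ)), inner_eq_one_iff_of_norm_eq_one hnE hevader.1, eq_comm]
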